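/- Let $\mathbb{H}=\{z\in\mathbb{C}:\operatorname{Im} z>0\}$ and let $a\neq b$ be real numbers. Let $\Omega$ be the collection of all simply connected compact sets $K\subset\overline{\mathbb{H}}$ (that is, $K$ and $\mathbb{C}\setminus K$ are connected) with $K\cap\mathbb{R}=\{a,b\}$, and let $\mathcal{Q}$ be the collection of all compact sets $A\subset\overline{\mathbb{H}}$ such that $\mathbb{H}\setminus A$ is simply connected and $a,b\notin A$. For $A\in\mathcal{Q}$, let $f_A$ denote any conformal map from $\mathbb{H}\setminus A$ onto $\mathbb{H}$ that leaves $a$ and $b$ fixed. A *chordal restriction measure* in $\mathbb{H}$ between $a$ and $b$ is a probability law of a random set $K\in\Omega$ such that (1) the law of $K$ is invariant under the conformal maps from $\mathbb{H}$ onto itself that fix $a$ and $b$, and (2) for every $A\in\mathcal{Q}$, conditionally on $K\cap A=\emptyset$, the set $f_A(K)$ is distributed as $K$. It has *exponent* $\alpha$ if $\mathbb{P}(K\cap A=\emptyset)=(f_A'(a)f_A'(b))^{\alpha}$ for all $A\in\mathcal{Q}$. For $r\in\mathbb{R}$ and $\varepsilon>0$, let $D(r,\varepsilon)=\{z\in\mathbb{C}:|z-r|<\varepsilon\}$.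 **Lemma.** Let $a,b,r_1,r_2\in\mathbb{R}$ be four distinct points, and let $K$ be distributed as a chordal restriction measure in $\mathbb{H}$ between $a$ and $b$ with exponent $\alpha$. Then, for $0<\varepsilon\le 1$, $$ \begin{aligned} \mathbb{P}\big[K\cap D(r_1,\varepsilon)\neq\emptyset,\ K\cap D(r_2,\varepsilon)\neq\emptyset\big] ={}&\frac{\alpha(\alpha-1)(a-b)^4\,\varepsilon^4}{(r_1-a)^2(r_2-a)^2(r_1-b)^2(r_2-b)^2}\\ &+\frac{\alpha(a-b)^2\,\varepsilon^4}{(r_1-b)^2(r_2-a)^2(r_2-r_1)^2} +\frac{\alpha(a-b)^2\,\varepsilon^4}{(r_1-a)^2(r_2-b)^2(r_2-r_1)^2} +R(\varepsilon), \end{aligned} $$ where $|R(\varepsilon)|\le C\varepsilon^5$ for all $0<\varepsilon\le 1$, with a constant $C$ that depends only on $a,b,r_1,r_2$ and $\alpha$. -/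

import Mathlib

open MeasureTheory Set Topology TopologicalSpace UpperHalfPlane

namespace ChordalRestriction

/-- Nonempty compact subsets of the plane, with the topology of the Hausdorff metric,
carry the Borel sigma-algebra. -/
noncomputable instance instMeasurableSpaceCompacts : MeasurableSpace (NonemptyCompacts ℂ) :=
  borel (NonemptyCompacts ℂ)

instance instBorelSpaceCompacts : BorelSpace (NonemptyCompacts ℂ) := ⟨rfl⟩

/-- The space `Ω` of the simply connected compact sets in the closed upper half-plane that meet
the real line exactly at `a` and `b`.  As usual for compact plane sets, simply connected means
connected with connected complement. -/
def IsChordalSet (a b : ℝ) (K : Set ℂ) : Prop :=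
  IsCompact K ∧ IsConnected K ∧ IsConnected Kᶜ ∧ K ⊆ {z : ℂ | 0 ≤ z.im} ∧
    K ∩ {z : ℂ | z.im = 0} = {(a : ℂ), (b : ℂ)}

/-- The class `𝒬` of the compact sets `A` in the closed upper half-plane `ℍ ∪ ℝ` such that `ℍ \ A`
is simply connected and `a, b ∉ A`. -/
structure IsHull (a b : ℝ) (A : Set ℂ) : Prop where
  isCompact : IsCompact A
  subset_closure : A ⊆ {z : ℂ | 0 ≤ z.im}
  isSimplyConnected : IsSimplyConnected (upperHalfPlaneSet \ A)
  left_notMem : (a : ℂ) ∉ A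
  right_notMem : (b : ℂ) ∉ A

/-- `f` is a conformal map from `U` onto the upper half-plane that extends continuously to the
boundary points `a` and `b` of `U` and leaves them fixed. -/
structure IsConformalFixing (a b : ℝ) (U : Set ℂ) (f : ℂ → ℂ) : Prop where
  differentiableOn : DifferentiableOn ℂ f U
  bijOn : BijOn f U upperHalfPlaneSet
  map_left : f a = a
  map_right : f b = b
  continuous_left : ContinuousWithinAt f U a
  continuous_right : ContinuousWithinAt f U b

/-- The event that the image `f(K)` of the random set `K` is a nonempty compact set in `E`. -/
def imageEvent (f : ℂ → ℂ) (E : Set (NonemptyCompacts ℂ)) : Set (NonemptyCompacts ℂ) :=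
  {K | ∃ L ∈ E, (L : Set ℂ) = f '' (K : Set ℂ)}

/-- The event `K ∩ A = ∅`. -/
def missEvent (A : Set ℂ) : Set (NonemptyCompacts ℂ) :=
  {K | (K : Set ℂ) ∩ A = ∅}

/-- The event `K ∩ A ≠ ∅`. -/
def hitEvent (A : Set ℂ) : Set (NonemptyCompacts ℂ) :=
  {K | (K : Set ℂ) ∩ A ≠ ∅}

/-- Chordal conformal restriction in the upper half-plane, from `a` to `b`: `μ` is the law of a
random set `K` in `Ω`, it is invariant under the conformal automorphisms of the upper half-plane
that fix `a` and `b`, and for every `A` in `𝒬` the law of `f_A(K)` conditionally on `K ∩ A = ∅`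
is `μ`, where `f_A` is a conformal map from `ℍ \ A` onto `ℍ` that fixes `a` and `b`. -/
structure IsChordalRestrictionLaw (a b : ℝ) (μ : Measure (NonemptyCompacts ℂ)) : Prop where
  isProbabilityMeasure : IsProbabilityMeasure μ
  ae_isChordalSet : ∀ᵐ K : NonemptyCompacts ℂ ∂μ, IsChordalSet a b (K : Set ℂ)
  conformal_invariance : ∀ φ : ℂ → ℂ, IsConformalFixing a b upperHalfPlaneSet φ →
    ∀ E : Set (NonemptyCompacts ℂ), MeasurableSet E → μ (imageEvent φ E) = μ E
  restriction : ∀ A : Set ℂ, IsHull a b A →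
    ∀ f : ℂ → ℂ, IsConformalFixing a b (upperHalfPlaneSet \ A) f →
    ∀ E : Set (NonemptyCompacts ℂ), MeasurableSet E →
      μ (missEvent A ∩ imageEvent f E) = μ (missEvent A) * μ E

/-- A chordal restriction measure in the upper half-plane from `a` to `b` has exponent `α` if
`ℙ(K ∩ A = ∅) = (f_A'(a) f_A'(b)) ^ α` for every `A` in `𝒬`.  The boundary derivatives of `f_A`
at `a` and `b` exist and are positive real numbers, by Schwarz reflection. -/
structure IsChordalRestrictionMeasure (a b α : ℝ) (μ : Measure (NonemptyCompacts ℂ)) : Prop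
    extends IsChordalRestrictionLaw a b μ where
  exponent : ∀ A : Set ℂ, IsHull a b A →
    ∀ f : ℂ → ℂ, IsConformalFixing a b (upperHalfPlaneSet \ A) f →
    ∀ da db : ℝ, HasDerivWithinAt f (da : ℂ) (upperHalfPlaneSet \ A) (a : ℂ) →
      HasDerivWithinAt f (db : ℂ) (upperHalfPlaneSet \ A) (b : ℂ) →
      μ.real (missEvent A) = (da * db) ^ α

end ChordalRestriction

/-!
The event that `K` hits both discs is treated by inclusion and exclusion, which reduces everything
to the probabilities of missing one half-disc and of missing the union of two.

For the half-disc of radius `ε` about `r` the Joukowski map `z ↦ z + ε ^ 2 / (z - r)`, followed by a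
real affine map, is the conformal map in the definition of the exponent.  With `x = a - r` and
`y = b - r` the probability of missing it is `discFactor x y (ε ^ 2) ^ α`, where
`discFactor x y t = 1 - t * (x - y) ^ 2 / (x * y - t) ^ 2`
(`IsChordalRestrictionMeasure.measureReal_missEvent_halfDisc`).

The conformal map for the union of two half-discs is not elementary.  Instead, the union is
enclosed between two sets whose conformal map is a composition of two Joukowski maps: the
half-disc about `r₁` together with the preimage, under the Joukowski map of that half-disc, of a
half-disc about the image of `r₂`.  Near `r₂` that Joukowski map is a dilation by
`1 - ε ^ 2 / (r₂ - r₁) ^ 2` up to a relative error `O(ε ^ 3)`.  Hence the radii of the inner and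
the outer set can be taken to differ by `O(ε ^ 4)`, which moves the probabilities, in which the
radius enters through its square, by `O(ε ^ 5)` only (`halfDisc_union_subset_iteratedHull`,
`iteratedHull_subset_halfDisc_union`).

For these sets the probability of missing them is `(f₁ * f₃) ^ α`, where `f₁` and `f₂` are the
factors of the half-discs and `f₃ - f₂` is of order `ε ^ 4`.  Inclusion and exclusion gives
`(1 - f₁ ^ α) * (1 - f₂ ^ α) + f₁ ^ α * (f₃ ^ α - f₂ ^ α)`.  Both terms are `ε ^ 4` times functions
that are differentiable at `ε = 0`, and the values of these functions at `0` give the leading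
coefficient (`isBigO_discFactor_inclusion_exclusion`).
-/

namespace ChordalRestriction

/-! ### Joukowski maps and the exponent formula -/

/-- The Joukowski map `z ↦ z + ρ² / (z - c)`, which maps the complement in `ℍ` of the half-disc of
radius `ρ` about the real point `c` conformally onto `ℍ`. -/
noncomputable def joukowski (c ρ : ℝ) (z : ℂ) : ℂ := z + (ρ : ℂ) ^ 2 / (z - c)

theorem joukowski_ofReal (c ρ x : ℝ) :
    joukowski c ρ x = ((x + ρ ^ 2 / (x - c) : ℝ) : ℂ) := by
  simp [joukowski]

theorem hasDerivAt_joukowski {c ρ : ℝ} {z : ℂ} (hz : z ≠ c) :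
    HasDerivAt (joukowski c ρ) (1 - (ρ : ℂ) ^ 2 / (z - c) ^ 2) z := by
  have hz' := sub_ne_zero.2 hz
  have h : HasDerivAt (joukowski c ρ) _ z := (hasDerivAt_id z).fun_add
    ((hasDerivAt_const z ((ρ : ℂ) ^ 2)).fun_div ((hasDerivAt_id z).sub_const (c : ℂ)) hz')
  convert h using 1
  field_simp
  ring

theorem joukowski_im (c ρ : ℝ) (z : ℂ) :
    (joukowski c ρ z).im = z.im * (1 - ρ ^ 2 / ‖z - c‖ ^ 2) := by
  have h : ((ρ : ℂ) ^ 2 / (z - c)).im = ρ ^ 2 * (-z.im / ‖z - c‖ ^ 2) := by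
    rw [div_eq_mul_inv, ← Complex.ofReal_pow, Complex.im_ofReal_mul, Complex.inv_im,
      Complex.normSq_eq_norm_sq]
    simp
  rw [joukowski, Complex.add_im, h]
  ring

theorem joukowski_sub_joukowski {c ρ : ℝ} {z w : ℂ} (hz : z ≠ c) (hw : w ≠ c) :
    joukowski c ρ z - joukowski c ρ w = (z - w) * (1 - (ρ : ℂ) ^ 2 / ((z - c) * (w - c))) := by
  have hz' := sub_ne_zero.2 hz
  have hw' := sub_ne_zero.2 hw
  unfold joukowski
  field_simp
  ring

theorem ne_center_of_notMem_closedBall {c ρ : ℝ} (hρ : 0 ≤ ρ) {z : ℂ}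
    (hz : z ∉ Metric.closedBall (c : ℂ) ρ) : z ≠ c := by
  rintro rfl
  exact hz (Metric.mem_closedBall_self hρ)

theorem bijOn_joukowski {c ρ : ℝ} (hρ : 0 < ρ) :
    BijOn (joukowski c ρ) (upperHalfPlaneSet \ Metric.closedBall (c : ℂ) ρ)
      upperHalfPlaneSet := by
  have key : ∀ z : ℂ, ρ < ‖z - c‖ → 0 < 1 - ρ ^ 2 / ‖z - c‖ ^ 2 := by
    intro z hz
    have h0 : 0 < ‖z - c‖ := hρ.trans hz
    rw [sub_pos, div_lt_one (by positivity)]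
    gcongr
  refine ⟨?_, ?_, ?_⟩
  · rintro z ⟨hz, hzc⟩
    rw [Metric.mem_closedBall, not_le, dist_eq_norm] at hzc
    change 0 < (joukowski c ρ z).im
    rw [joukowski_im]
    exact mul_pos hz (key z hzc)
  · rintro z ⟨-, hz⟩ w ⟨-, hw⟩ h
    have hzc := ne_center_of_notMem_closedBall hρ.le hz
    have hwc := ne_center_of_notMem_closedBall hρ.le hw
    have h1 := joukowski_sub_joukowski (ρ := ρ) hzc hwc
    rw [h, sub_self, eq_comm, mul_eq_zero, sub_eq_zero, sub_eq_zero] at h1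
    refine h1.resolve_right fun h2 => ?_
    rw [Metric.mem_closedBall, not_le, dist_eq_norm] at hz hw
    rw [eq_comm, div_eq_one_iff_eq
      (mul_ne_zero (sub_ne_zero.2 hzc) (sub_ne_zero.2 hwc))] at h2
    have h3 := congrArg norm h2
    rw [norm_mul, norm_pow, Complex.norm_real, Real.norm_of_nonneg hρ.le] at h3
    nlinarith
  · -- The preimages of `w` are the roots of a quadratic whose roots have product `ρ ^ 2`.
    intro w hw
    change 0 < w.im at hw
    obtain ⟨δ, hδ⟩ := IsAlgClosed.exists_pow_nat_eq ((w - c) ^ 2 - 4 * (ρ : ℂ) ^ 2) two_pos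
    have hρ' : (ρ : ℂ) ≠ 0 := by exact_mod_cast hρ.ne'
    have main : ∀ u v : ℂ, u + v = w - c → u * v = (ρ : ℂ) ^ 2 → ρ < ‖u‖ →
        w ∈ joukowski c ρ '' (upperHalfPlaneSet \ Metric.closedBall (c : ℂ) ρ) := by
      intro u v h1 h2 h3
      have hu : u ≠ 0 := by
        rintro rfl
        simp only [norm_zero] at h3
        linarith
      have hJ : joukowski c ρ (u + c) = w := by
        rw [joukowski, add_sub_cancel_right, ← h2, mul_div_cancel_left₀ _ hu]
        linear_combination h1
      refine ⟨u + c, ⟨?_, ?_⟩, hJ⟩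
      · have h4 := joukowski_im c ρ (u + c)
        rw [hJ] at h4
        have h5 := key (u + c) (by simpa using h3)
        change 0 < (u + c).im
        rw [h4] at hw
        exact pos_of_mul_pos_left hw h5.le
      · rw [Metric.mem_closedBall, not_le, dist_eq_norm]
        simpa using h3
    have e1 : ((w - c + δ) / 2) + ((w - c - δ) / 2) = w - c := by ring
    have e2 : ((w - c + δ) / 2) * ((w - c - δ) / 2) = (ρ : ℂ) ^ 2 := by
      linear_combination (-1 / 4) * hδ
    generalize (w - c + δ) / 2 = u at e1 e2
    generalize (w - c - δ) / 2 = v at e1 e2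
    have e3 := congrArg norm e2
    rw [norm_mul, norm_pow, Complex.norm_real, Real.norm_of_nonneg hρ.le] at e3
    rcases lt_trichotomy ρ ‖u‖ with h | h | h
    · exact main u v e1 e2 h
    · exfalso
      have hu : u ≠ 0 := by
        rw [← norm_pos_iff, ← h]
        exact hρ
      have h4 := joukowski_im c ρ (u + c)
      have hJ : joukowski c ρ (u + c) = w := by
        rw [joukowski, add_sub_cancel_right, ← e2, mul_div_cancel_left₀ _ hu]
        linear_combination e1
      rw [hJ, add_sub_cancel_right, ← h, div_self (by positivity)] at h4
      simp only [sub_self, mul_zero] at h4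
      exact hw.ne' h4
    · refine main v u (by rw [add_comm]; exact e1) (by rw [mul_comm]; exact e2) ?_
      by_contra! hv
      nlinarith [norm_nonneg u, norm_nonneg v]

/-- A domain that an injective holomorphic function maps onto `ℍ` is simply connected: by the open
mapping theorem the map is a homeomorphism, and `ℍ` is convex. -/
theorem isSimplyConnected_of_bijOn_upperHalfPlaneSet {U : Set ℂ} {f : ℂ → ℂ} (hU : IsOpen U)
    (hf : DifferentiableOn ℂ f U) (hbij : BijOn f U upperHalfPlaneSet) :
    IsSimplyConnected U := by
  have hH : IsSimplyConnected upperHalfPlaneSet := by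
    have hconv : Convex ℝ upperHalfPlaneSet := convex_halfSpace_im_gt 0
    have := hconv.contractibleSpace ⟨Complex.I, by simp⟩
    exact SimplyConnectedSpace.ofContractible _
  have hcont : Continuous (MapsTo.restrict f U upperHalfPlaneSet hbij.mapsTo) :=
    hf.continuousOn.mapsToRestrict hbij.mapsTo
  have hopen : ∀ z ∈ U, 𝓝 (f z) ≤ Filter.map f (𝓝 z) := by
    intro z hz
    refine ((hf.analyticAt (hU.mem_nhds hz)).eventually_constant_or_nhds_le_map_nhds).resolve_left
      fun h => ?_
    have h1 : ∀ᶠ w in 𝓝 z, w = z := by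
      filter_upwards [h, hU.mem_nhds hz] with w hw hwU using hbij.injOn hwU hz hw
    have h2 : ({z} : Set ℂ) ∈ 𝓝 z := h1
    exact not_isOpen_singleton z (isOpen_singleton_iff_nhds_eq_pure z |>.2
      (le_antisymm (by simpa using h2) (pure_le_nhds z)))
  have hom : IsOpenMap (MapsTo.restrict f U upperHalfPlaneSet hbij.mapsTo) := by
    rw [isOpenMap_iff_nhds_le]
    rintro ⟨z, hz⟩
    intro S hS
    rw [Filter.mem_map, mem_nhds_subtype] at hS
    obtain ⟨u, hu, hus⟩ := hS
    rw [mem_nhds_subtype]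
    refine ⟨f '' (u ∩ U), hopen z hz (Filter.image_mem_map
      (Filter.inter_mem hu (hU.mem_nhds hz))), ?_⟩
    rintro ⟨w, hw⟩ ⟨y, ⟨hyu, hyU⟩, rfl⟩
    exact hus (show (⟨y, hyU⟩ : U) ∈ _ from hyu)
  let e : U ≃ₜ upperHalfPlaneSet :=
    (Equiv.ofBijective _ hbij.bijective :
      U ≃ upperHalfPlaneSet).toHomeomorphOfContinuousOpen hcont hom
  exact e.toHomotopyEquiv.simplyConnectedSpace_iff.2 hH

/-- The exponent formula for a conformal map that need not fix `a` and `b`: it is followed by the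
real affine map that restores these two points. -/
theorem IsChordalRestrictionMeasure.measureReal_missEvent {a b α : ℝ}
    {μ : Measure (NonemptyCompacts ℂ)} (hμ : IsChordalRestrictionMeasure a b α μ) {A : Set ℂ}
    (hA : IsCompact A) (hsub : A ⊆ {z : ℂ | 0 ≤ z.im}) (ha : (a : ℂ) ∉ A) (hb : (b : ℂ) ∉ A)
    {f : ℂ → ℂ} (hf : DifferentiableOn ℂ f (upperHalfPlaneSet \ A))
    (hbij : BijOn f (upperHalfPlaneSet \ A) upperHalfPlaneSet) {fa fb da db : ℝ}
    (hfa : f a = fa) (hfb : f b = fb) (hda : HasDerivAt f (da : ℂ) (a : ℂ))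
    (hdb : HasDerivAt f (db : ℂ) (b : ℂ)) (hpos : 0 < (a - b) / (fa - fb)) :
    μ.real (missEvent A) = (da * db * ((a - b) / (fa - fb)) ^ 2) ^ α := by
  set k : ℝ := (a - b) / (fa - fb) with hk
  have hfab : fa - fb ≠ 0 := by
    intro h
    rw [hk, h, div_zero] at hpos
    exact hpos.false
  have hkmul : k * (fa - fb) = a - b := div_mul_cancel₀ _ hfab
  let g : ℂ → ℂ := fun z => (k : ℂ) * (f z - fa) + a
  have hH : IsOpen upperHalfPlaneSet := isOpen_upperHalfPlaneSet
  have hU : IsOpen (upperHalfPlaneSet \ A) := hH.sdiff hA.isClosed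
  have haff : BijOn (fun z : ℂ => (k : ℂ) * (z - fa) + a) upperHalfPlaneSet
      upperHalfPlaneSet := by
    have hk0 : (k : ℂ) ≠ 0 := by exact_mod_cast hpos.ne'
    refine ⟨?_, ?_, ?_⟩
    · intro z (hz : 0 < z.im)
      change 0 < ((k : ℂ) * (z - fa) + a).im
      simpa using mul_pos hpos hz
    · intro z _ w _ h
      simpa [hk0] using h
    · intro w (hw : 0 < w.im)
      refine ⟨((k⁻¹ : ℝ) : ℂ) * (w - a) + fa, ?_, ?_⟩
      · change 0 < (((k⁻¹ : ℝ) : ℂ) * (w - a) + fa).im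
        rw [Complex.add_im, Complex.im_ofReal_mul]
        simpa using mul_pos (inv_pos.2 hpos) hw
      · simp only [add_sub_cancel_right, Complex.ofReal_inv]
        field_simp
        ring
  have hg : ∀ {d : ℂ} {z : ℂ}, HasDerivAt f d z → HasDerivAt g (k * d) z := fun h =>
    ((h.sub_const _).const_mul _).add_const _
  have hhull : IsHull a b A :=
    ⟨hA, hsub, isSimplyConnected_of_bijOn_upperHalfPlaneSet hU hf hbij, ha, hb⟩
  have hconf : IsConformalFixing a b (upperHalfPlaneSet \ A) g := by
    refine ⟨((hf.sub_const _).const_mul _).add_const _, haff.comp hbij, ?_, ?_,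
      (hg hda).continuousAt.continuousWithinAt, (hg hdb).continuousAt.continuousWithinAt⟩
    · simp [g, hfa]
    · have h : k * (fb - fa) + a = b := by linarith
      simp only [g, hfb]
      exact_mod_cast h
  have h := hμ.exponent A hhull g hconf (k * da) (k * db)
    (by simpa using (hg hda).hasDerivWithinAt) (by simpa using (hg hdb).hasDerivWithinAt)
  rw [h]
  congr 1
  ring

/-! ### Missing a half-disc or an iterated hull -/

/-- The closed half-disc of radius `ε` about the real point `r`. -/
def halfDisc (r ε : ℝ) : Set ℂ := {z | 0 ≤ z.im} ∩ Metric.closedBall (r : ℂ) ε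

/-- The half-disc of radius `ε` about `r`, together with the preimage under `joukowski r ε` of the
half-disc of radius `ρ` about `s`.  The map `joukowski s ρ ∘ joukowski r ε` takes its complement
in `ℍ` onto `ℍ`.  The junk value of `joukowski r ε` at `r` does not matter, since `r` lies in the
first disc. -/
def iteratedHull (r ε s ρ : ℝ) : Set ℂ :=
  {z | 0 ≤ z.im} ∩
    (Metric.closedBall (r : ℂ) ε ∪ joukowski r ε ⁻¹' Metric.closedBall (s : ℂ) ρ)

/-- The restriction of `joukowski c ρ` to the real line. -/
noncomputable def realJoukowski (c ρ x : ℝ) : ℝ := x + ρ ^ 2 / (x - c)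

/-- For the half-disc of radius `ρ` about `0` and real points `x`, `y` outside it, the value
`f'(x) f'(y)` at `t = ρ ^ 2`, where `f` is a conformal map of the complement onto `ℍ` that fixes
`x` and `y`. -/
noncomputable def discFactor (x y t : ℝ) : ℝ := 1 - t * (x - y) ^ 2 / (x * y - t) ^ 2

theorem isClosed_closedUpperHalfPlane : IsClosed {z : ℂ | 0 ≤ z.im} :=
  isClosed_le continuous_const Complex.continuous_im

theorem isCompact_halfDisc (r ε : ℝ) : IsCompact (halfDisc r ε) :=
  (isCompact_closedBall _ _).inter_left isClosed_closedUpperHalfPlane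

theorem isCompact_iteratedHull {r ε : ℝ} (hε : 0 < ε) (s ρ : ℝ) :
    IsCompact (iteratedHull r ε s ρ) := by
  -- Clearing the denominator gives a description by non-strict inequalities between functions
  -- that are continuous on the whole plane.
  have heq : Metric.closedBall (r : ℂ) ε ∪ joukowski r ε ⁻¹' Metric.closedBall (s : ℂ) ρ =
      {z : ℂ | ‖z - r‖ ≤ ε} ∪ {z : ℂ | ‖(z - s) * (z - r) + (ε : ℂ) ^ 2‖ ≤ ρ * ‖z - r‖} ∩
        {z : ℂ | ε ≤ ‖z - r‖} := by
    ext z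
    simp only [mem_union, mem_inter_iff, Metric.mem_closedBall, mem_preimage, mem_ofPred_eq,
      dist_eq_norm]
    by_cases h : ‖z - r‖ ≤ ε
    · simp [h]
    · have hz0 : 0 < ‖z - r‖ := hε.trans (not_le.1 h)
      have hz : z - r ≠ 0 := norm_pos_iff.1 hz0
      have e : (z - s) * (z - r) + (ε : ℂ) ^ 2 = (joukowski r ε z - s) * (z - r) := by
        unfold joukowski
        field_simp
        ring
      rw [e, norm_mul, mul_le_mul_iff_of_pos_right hz0]
      simp [h, (not_le.1 h).le]
  have hcl : IsClosed (iteratedHull r ε s ρ) := by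
    rw [iteratedHull, heq]
    refine isClosed_closedUpperHalfPlane.inter (.union ?_ (.inter ?_ ?_))
    · exact isClosed_le (by fun_prop) (by fun_prop)
    · exact isClosed_le (by fun_prop) (by fun_prop)
    · exact isClosed_le (by fun_prop) (by fun_prop)
  refine Metric.isCompact_of_isClosed_isBounded hcl ?_
  refine (Metric.isBounded_closedBall (x := (0 : ℂ)) (r := |r| + ε + (|s| + |ρ|))).subset ?_
  rintro z ⟨-, hz⟩
  rw [mem_closedBall_zero_iff]
  have hr : ‖(r : ℂ)‖ = |r| := by simp
  have hs : ‖(s : ℂ)‖ = |s| := by simp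
  have t1 : ‖z‖ ≤ ‖z - r‖ + ‖(r : ℂ)‖ := by simpa using norm_add_le (z - r) (r : ℂ)
  by_cases h : ‖z - r‖ ≤ ε
  · linarith [abs_nonneg s, abs_nonneg ρ]
  · rcases hz with hz | hz
    · exact absurd (by simpa [dist_eq_norm] using hz) h
    · rw [mem_preimage, Metric.mem_closedBall, dist_eq_norm] at hz
      have hz0 : 0 < ‖z - r‖ := hε.trans (not_le.1 h)
      have t2 : z = (joukowski r ε z - s) + s - (ε : ℂ) ^ 2 / (z - r) := by
        unfold joukowski
        ring
      have t3 : ‖(ε : ℂ) ^ 2 / (z - r)‖ ≤ ε := by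
        rw [norm_div, norm_pow, Complex.norm_real, Real.norm_of_nonneg hε.le, div_le_iff₀ hz0]
        nlinarith [not_le.1 h]
      have t4 : ‖z‖ ≤ ‖joukowski r ε z - s‖ + ‖(s : ℂ)‖ + ‖(ε : ℂ) ^ 2 / (z - r)‖ := by
        calc ‖z‖ = ‖(joukowski r ε z - s) + s - (ε : ℂ) ^ 2 / (z - r)‖ := by rw [← t2]
          _ ≤ _ := (norm_sub_le _ _).trans (by gcongr; exact norm_add_le _ _)
      linarith [abs_nonneg r, le_abs_self ρ]

theorem hasDerivAt_joukowski_ofReal {c ρ x : ℝ} (hx : x ≠ c) :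
    HasDerivAt (joukowski c ρ) ((1 - ρ ^ 2 / (x - c) ^ 2 : ℝ) : ℂ) (x : ℂ) := by
  simpa using hasDerivAt_joukowski (ρ := ρ) (show (x : ℂ) ≠ c by exact_mod_cast hx)

theorem ofReal_notMem_closedBall {c ρ x : ℝ} (h : ρ < |x - c|) :
    (x : ℂ) ∉ Metric.closedBall (c : ℂ) ρ := by
  rw [Metric.mem_closedBall, not_le, dist_eq_norm, ← Complex.ofReal_sub, Complex.norm_real]
  exact h

theorem upperHalfPlaneSet_sdiff_inter (S : Set ℂ) :
    upperHalfPlaneSet \ ({z : ℂ | 0 ≤ z.im} ∩ S) = upperHalfPlaneSet \ S := by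
  ext z
  simp only [mem_sdiff, mem_inter_iff, mem_ofPred_eq, not_and]
  exact and_congr_right fun hz => ⟨fun h => h (le_of_lt hz), fun h _ => h⟩

theorem realJoukowski_sub {c ρ x y : ℝ} (hx : x ≠ c) (hy : y ≠ c) :
    realJoukowski c ρ x - realJoukowski c ρ y =
      (x - y) * (1 - ρ ^ 2 / ((x - c) * (y - c))) := by
  have hx' := sub_ne_zero.2 hx
  have hy' := sub_ne_zero.2 hy
  unfold realJoukowski
  field_simp
  ring

theorem sq_lt_abs_mul {x y ρ : ℝ} (hρ : 0 < ρ) (hx : ρ < |x|) (hy : ρ < |y|) :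
    ρ ^ 2 < |x * y| := by
  rw [abs_mul, sq]
  exact mul_lt_mul'' hx hy hρ.le hρ.le

theorem div_realJoukowski_sub_pos {c ρ x y : ℝ} (hρ : 0 < ρ) (hx : ρ < |x - c|)
    (hy : ρ < |y - c|) (hxy : x ≠ y) :
    0 < (x - y) / (realJoukowski c ρ x - realJoukowski c ρ y) := by
  have hx0 : x - c ≠ 0 := abs_pos.1 (hρ.trans hx)
  have hy0 : y - c ≠ 0 := abs_pos.1 (hρ.trans hy)
  rw [realJoukowski_sub (sub_ne_zero.1 hx0) (sub_ne_zero.1 hy0), div_mul_cancel_left₀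
    (sub_ne_zero.2 hxy), inv_pos, sub_pos]
  refine lt_of_abs_lt ?_
  rw [abs_div, abs_of_nonneg (sq_nonneg ρ), div_lt_one (abs_pos.2 (mul_ne_zero hx0 hy0))]
  exact sq_lt_abs_mul hρ hx hy

theorem discFactor_eq {c ρ x y : ℝ} (hρ : 0 < ρ) (hx : ρ < |x - c|)
    (hy : ρ < |y - c|) (hxy : x ≠ y) :
    (1 - ρ ^ 2 / (x - c) ^ 2) * (1 - ρ ^ 2 / (y - c) ^ 2) *
      ((x - y) / (realJoukowski c ρ x - realJoukowski c ρ y)) ^ 2 =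
      discFactor (x - c) (y - c) (ρ ^ 2) := by
  have hx0 : x - c ≠ 0 := abs_pos.1 (hρ.trans hx)
  have hy0 : y - c ≠ 0 := abs_pos.1 (hρ.trans hy)
  rw [realJoukowski_sub (sub_ne_zero.1 hx0) (sub_ne_zero.1 hy0), div_mul_cancel_left₀
    (sub_ne_zero.2 hxy), discFactor]
  have h1 := sq_lt_abs_mul hρ hx hy
  have hD : (x - c) * (y - c) - ρ ^ 2 ≠ 0 := by
    intro h
    rw [sub_eq_zero] at h
    rw [h, abs_of_nonneg (sq_nonneg ρ)] at h1
    exact h1.false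
  have hD' : 1 - ρ ^ 2 / ((x - c) * (y - c)) =
      ((x - c) * (y - c) - ρ ^ 2) / ((x - c) * (y - c)) := by
    field_simp
  rw [hD']
  field_simp
  ring

variable {a b α : ℝ} {μ : Measure (NonemptyCompacts ℂ)}

/-- The probability of missing one half-disc. -/
theorem IsChordalRestrictionMeasure.measureReal_missEvent_halfDisc
    (hμ : IsChordalRestrictionMeasure a b α μ) (hab : a ≠ b) {r ε : ℝ} (hε : 0 < ε)
    (ha : ε < |a - r|) (hb : ε < |b - r|) :
    μ.real (missEvent (halfDisc r ε)) = discFactor (a - r) (b - r) (ε ^ 2) ^ α := by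
  have har : a ≠ r := sub_ne_zero.1 (abs_pos.1 (hε.trans ha))
  have hbr : b ≠ r := sub_ne_zero.1 (abs_pos.1 (hε.trans hb))
  rw [← discFactor_eq hε ha hb hab]
  refine hμ.measureReal_missEvent (f := joukowski r ε) (isCompact_halfDisc r ε)
    inter_subset_left (fun h => ofReal_notMem_closedBall ha h.2)
    (fun h => ofReal_notMem_closedBall hb h.2) ?_ ?_ (joukowski_ofReal _ _ _)
    (joukowski_ofReal _ _ _) (hasDerivAt_joukowski_ofReal har) (hasDerivAt_joukowski_ofReal hbr)
    (div_realJoukowski_sub_pos hε ha hb hab)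
  · intro z hz
    rw [halfDisc, upperHalfPlaneSet_sdiff_inter] at hz
    exact (hasDerivAt_joukowski (ne_center_of_notMem_closedBall hε.le
      hz.2)).differentiableAt.differentiableWithinAt
  · rw [halfDisc, upperHalfPlaneSet_sdiff_inter]
    exact bijOn_joukowski hε

/-- The probability of missing an iterated hull factorizes, because the conformal map is a
composition of two Joukowski maps. -/
theorem IsChordalRestrictionMeasure.measureReal_missEvent_iteratedHull
    (hμ : IsChordalRestrictionMeasure a b α μ) (hab : a ≠ b) {r ε s ρ : ℝ} (hε : 0 < ε)
    (hρ : 0 < ρ) (ha : ε < |a - r|) (hb : ε < |b - r|)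
    (ha' : ρ < |realJoukowski r ε a - s|) (hb' : ρ < |realJoukowski r ε b - s|) :
    μ.real (missEvent (iteratedHull r ε s ρ)) =
      (discFactor (a - r) (b - r) (ε ^ 2) *
        discFactor (realJoukowski r ε a - s) (realJoukowski r ε b - s) (ρ ^ 2)) ^ α := by
  have har : a ≠ r := sub_ne_zero.1 (abs_pos.1 (hε.trans ha))
  have hbr : b ≠ r := sub_ne_zero.1 (abs_pos.1 (hε.trans hb))
  have has : realJoukowski r ε a ≠ s := sub_ne_zero.1 (abs_pos.1 (hρ.trans ha'))
  have hbs : realJoukowski r ε b ≠ s := sub_ne_zero.1 (abs_pos.1 (hρ.trans hb'))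
  have hp := div_realJoukowski_sub_pos hε ha hb hab
  have hJ0 : realJoukowski r ε a - realJoukowski r ε b ≠ 0 := by
    intro h
    rw [h, div_zero] at hp
    exact hp.false
  have hp' := div_realJoukowski_sub_pos hρ ha' hb' (sub_ne_zero.1 hJ0)
  have hdiff : upperHalfPlaneSet \ iteratedHull r ε s ρ =
      (upperHalfPlaneSet \ Metric.closedBall (r : ℂ) ε) ∩
        joukowski r ε ⁻¹' (upperHalfPlaneSet \ Metric.closedBall (s : ℂ) ρ) := by
    rw [iteratedHull, upperHalfPlaneSet_sdiff_inter]
    ext z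
    simp only [mem_sdiff, mem_union, mem_inter_iff, mem_preimage, not_or]
    constructor
    · rintro ⟨h1, h2, h3⟩
      exact ⟨⟨h1, h2⟩, (bijOn_joukowski hε).mapsTo ⟨h1, h2⟩, h3⟩
    · rintro ⟨⟨h1, h2⟩, -, h3⟩
      exact ⟨h1, h2, h3⟩
  have hbij : BijOn (joukowski r ε) (upperHalfPlaneSet \ iteratedHull r ε s ρ)
      (upperHalfPlaneSet \ Metric.closedBall (s : ℂ) ρ) := by
    rw [hdiff]
    refine ⟨fun z hz => hz.2, (bijOn_joukowski hε).injOn.mono inter_subset_left, ?_⟩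
    intro w hw
    obtain ⟨z, hz, rfl⟩ := (bijOn_joukowski (c := r) hε).surjOn hw.1
    exact ⟨z, ⟨hz, hw⟩, rfl⟩
  have hd : ∀ {x : ℝ}, x ≠ r → realJoukowski r ε x ≠ s →
      HasDerivAt (joukowski s ρ ∘ joukowski r ε)
        (((1 - ρ ^ 2 / (realJoukowski r ε x - s) ^ 2) * (1 - ε ^ 2 / (x - r) ^ 2) : ℝ) : ℂ)
        (x : ℂ) := by
    intro x hx hxs
    have h1 := hasDerivAt_joukowski_ofReal (ρ := ρ) hxs
    rw [realJoukowski, ← joukowski_ofReal] at h1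
    rw [Complex.ofReal_mul]
    exact h1.comp (x : ℂ) (hasDerivAt_joukowski_ofReal hx)
  have hv : ∀ x : ℝ, (joukowski s ρ ∘ joukowski r ε) x =
      (realJoukowski s ρ (realJoukowski r ε x) : ℝ) := by
    intro x
    rw [Function.comp_apply, joukowski_ofReal, joukowski_ofReal, realJoukowski, realJoukowski]
  have hmem : ∀ {x : ℝ}, ε < |x - r| → ρ < |realJoukowski r ε x - s| →
      (x : ℂ) ∉ iteratedHull r ε s ρ := by
    rintro x h1 h2 ⟨-, h | h⟩
    · exact ofReal_notMem_closedBall h1 h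
    · rw [mem_preimage, joukowski_ofReal] at h
      exact ofReal_notMem_closedBall h2 h
  have hsplit : (a - b) / (realJoukowski s ρ (realJoukowski r ε a) -
      realJoukowski s ρ (realJoukowski r ε b)) =
      (a - b) / (realJoukowski r ε a - realJoukowski r ε b) *
      ((realJoukowski r ε a - realJoukowski r ε b) / (realJoukowski s ρ (realJoukowski r ε a) -
      realJoukowski s ρ (realJoukowski r ε b))) := by
    rw [div_mul_div_cancel₀ hJ0]
  rw [hμ.measureReal_missEvent (isCompact_iteratedHull hε s ρ) inter_subset_left (hmem ha ha')
    (hmem hb hb') (f := joukowski s ρ ∘ joukowski r ε) ?_ ((bijOn_joukowski hρ).comp hbij)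
    (hv a) (hv b) (hd har has) (hd hbr hbs) (by rw [hsplit]; exact mul_pos hp hp'), hsplit,
    ← discFactor_eq hε ha hb hab, ← discFactor_eq hρ ha' hb' (sub_ne_zero.1 hJ0)]
  · congr 1
    ring
  · intro z hz
    have h1 := hbij.mapsTo hz
    rw [hdiff] at hz
    exact ((hasDerivAt_joukowski (ne_center_of_notMem_closedBall hρ.le h1.2)).comp z
      (hasDerivAt_joukowski
        (ne_center_of_notMem_closedBall hε.le hz.1.2))).differentiableAt.differentiableWithinAt

/-! ### Inclusion and exclusion, and comparison with iterated hulls -/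

theorem missEvent_anti {A B : Set ℂ} (h : A ⊆ B) : missEvent B ⊆ missEvent A := by
  intro K hK
  exact eq_empty_of_subset_empty ((inter_subset_inter_right _ h).trans (subset_of_eq hK))

theorem missEvent_union (A B : Set ℂ) : missEvent (A ∪ B) = missEvent A ∩ missEvent B := by
  ext K
  change (K : Set ℂ) ∩ (A ∪ B) = ∅ ↔ (K : Set ℂ) ∩ A = ∅ ∧ (K : Set ℂ) ∩ B = ∅
  rw [inter_union_distrib_left, union_empty_iff]

theorem measurableSet_missEvent {A : Set ℂ} (hA : IsClosed A) : MeasurableSet (missEvent A) := by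
  have h : missEvent A = {K : NonemptyCompacts ℂ | (K : Set ℂ) ⊆ Aᶜ} := by
    ext K
    change (K : Set ℂ) ∩ A = ∅ ↔ _
    rw [← disjoint_iff_inter_eq_empty]
    exact disjoint_left
  rw [h]
  exact (NonemptyCompacts.isOpen_subsets_of_isOpen hA.isOpen_compl).measurableSet

/-- Almost surely, hitting an open disc about a real point and hitting the closed half-disc of the
same radius are the same: the probability of missing the closed half-disc is a continuous function
of the radius. -/
theorem IsChordalRestrictionMeasure.hitEvent_ball_ae_eq
    (hμ : IsChordalRestrictionMeasure a b α μ) (hab : a ≠ b) {r ε : ℝ} (hε : 0 < ε)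
    (ha : ε < |a - r|) (hb : ε < |b - r|)
    (hpos : 0 < discFactor (a - r) (b - r) (ε ^ 2)) :
    hitEvent (Metric.ball (r : ℂ) ε) =ᵐ[μ] (missEvent (halfDisc r ε))ᶜ := by
  have := hμ.isProbabilityMeasure
  have hsub : ∀ᵐ K : NonemptyCompacts ℂ ∂μ, (K : Set ℂ) ⊆ {z : ℂ | 0 ≤ z.im} :=
    hμ.ae_isChordalSet.mono fun K hK => hK.2.2.2.1
  have hmono : ∀ {S T : Set ℂ}, {z : ℂ | 0 ≤ z.im} ∩ S ⊆ T → missEvent T ≤ᵐ[μ] missEvent S := by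
    intro S T hST
    filter_upwards [hsub] with K hK hKT
    refine eq_empty_of_subset_empty fun z hz => ?_
    have hz' : z ∈ (K : Set ℂ) ∩ T := ⟨hz.1, hST ⟨hK hz.1, hz.2⟩⟩
    rwa [show (K : Set ℂ) ∩ T = ∅ from hKT] at hz'
  have h1 : missEvent (halfDisc r ε) ≤ᵐ[μ] missEvent (Metric.ball (r : ℂ) ε) :=
    hmono (inter_subset_inter_right _ Metric.ball_subset_closedBall)
  have h2 : μ.real (missEvent (Metric.ball (r : ℂ) ε)) ≤ μ.real (missEvent (halfDisc r ε)) := by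
    rw [hμ.measureReal_missEvent_halfDisc hab hε ha hb]
    have hden : (a - r) * (b - r) - ε ^ 2 ≠ 0 := by
      intro h
      have h1 := sq_lt_abs_mul hε ha hb
      rw [sub_eq_zero] at h
      rw [h, abs_of_nonneg (sq_nonneg ε)] at h1
      exact h1.false
    have hc : ContinuousAt (fun x : ℝ => discFactor (a - r) (b - r) (x ^ 2) ^ α) ε := by
      refine ContinuousAt.rpow_const ?_ (Or.inl hpos.ne')
      unfold discFactor
      fun_prop (disch := exact pow_ne_zero 2 hden)
    refine ge_of_tendsto (hc.tendsto.mono_left (nhdsWithin_le_nhds (s := Iio ε))) ?_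
    filter_upwards [self_mem_nhdsWithin, mem_nhdsWithin_of_mem_nhds (lt_mem_nhds hε)]
      with x (hx : x < ε) hx0
    rw [← hμ.measureReal_missEvent_halfDisc hab hx0 (hx.trans ha) (hx.trans hb)]
    exact measureReal_mono (missEvent_anti (inter_subset_right.trans
      (Metric.closedBall_subset_ball hx)))
  have h3 : missEvent (halfDisc r ε) =ᵐ[μ] missEvent (Metric.ball (r : ℂ) ε) := by
    refine ae_eq_of_ae_subset_of_measure_ge h1 ?_
      (measurableSet_missEvent (isCompact_halfDisc r ε).isClosed).nullMeasurableSet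
      (measure_ne_top _ _)
    exact (ENNReal.toReal_le_toReal (measure_ne_top _ _) (measure_ne_top _ _)).1 h2
  exact h3.symm.compl

/-- Inclusion and exclusion for two half-discs. -/
theorem IsChordalRestrictionMeasure.measureReal_hitEvent_inter
    (hμ : IsChordalRestrictionMeasure a b α μ) (hab : a ≠ b) {r₁ r₂ ε : ℝ} (hε : 0 < ε)
    (ha₁ : ε < |a - r₁|) (hb₁ : ε < |b - r₁|) (ha₂ : ε < |a - r₂|) (hb₂ : ε < |b - r₂|)
    (hpos₁ : 0 < discFactor (a - r₁) (b - r₁) (ε ^ 2))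
    (hpos₂ : 0 < discFactor (a - r₂) (b - r₂) (ε ^ 2)) :
    μ.real (hitEvent (Metric.ball (r₁ : ℂ) ε) ∩ hitEvent (Metric.ball (r₂ : ℂ) ε)) =
      1 - discFactor (a - r₁) (b - r₁) (ε ^ 2) ^ α - discFactor (a - r₂) (b - r₂) (ε ^ 2) ^ α +
        μ.real (missEvent (halfDisc r₁ ε ∪ halfDisc r₂ ε)) := by
  have := hμ.isProbabilityMeasure
  have hm : ∀ r : ℝ, MeasurableSet (missEvent (halfDisc r ε)) := fun r =>
    measurableSet_missEvent (isCompact_halfDisc r ε).isClosed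
  have hae : (hitEvent (Metric.ball (r₁ : ℂ) ε) ∩ hitEvent (Metric.ball (r₂ : ℂ) ε) :
      Set (NonemptyCompacts ℂ)) =ᵐ[μ]
      ((missEvent (halfDisc r₁ ε) ∪ missEvent (halfDisc r₂ ε))ᶜ : Set (NonemptyCompacts ℂ)) := by
    rw [compl_union]
    exact (hμ.hitEvent_ball_ae_eq hab hε ha₁ hb₁ hpos₁).inter
      (hμ.hitEvent_ball_ae_eq hab hε ha₂ hb₂ hpos₂)
  rw [measureReal_congr hae,
    probReal_compl_eq_one_sub ((hm r₁).union (hm r₂)),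
    ← hμ.measureReal_missEvent_halfDisc hab hε ha₁ hb₁,
    ← hμ.measureReal_missEvent_halfDisc hab hε ha₂ hb₂, missEvent_union]
  have h := measureReal_union_add_inter (μ := μ) (s := missEvent (halfDisc r₁ ε)) (hm r₂)
  linarith

/-- Near `r₂`, the map `joukowski r₁ ε` is a dilation by the factor `1 - ε ^ 2 / (r₂ - r₁) ^ 2`, up
to a relative error of order `ε ^ 3`. -/
theorem abs_norm_joukowski_factor_sub_le {r₁ r₂ ε : ℝ} (hε : 0 < ε) (hd : 4 * ε ≤ |r₂ - r₁|)
    {z : ℂ} (hz : ‖z - r₂‖ ≤ 2 * ε) :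
    |‖1 - (ε : ℂ) ^ 2 / ((z - r₁) * ((r₂ : ℂ) - r₁))‖ - (1 - ε ^ 2 / (r₂ - r₁) ^ 2)| ≤
      4 / |r₂ - r₁| ^ 3 * ε ^ 3 := by
  set d : ℝ := r₂ - r₁ with hdd
  have hd0 : 0 < |d| := by linarith
  have hdc : ‖(d : ℂ)‖ = |d| := by simp
  have hdc0 : (d : ℂ) ≠ 0 := by rw [← norm_pos_iff, hdc]; exact hd0
  rw [show (r₂ : ℂ) - r₁ = (d : ℂ) by simp [hdd]]
  have hz1 : |d| / 2 ≤ ‖z - r₁‖ := by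
    have h := norm_sub_le (z - r₁) (z - r₂)
    rw [show z - r₁ - (z - r₂) = (d : ℂ) by simp [hdd], hdc] at h
    linarith
  have hz10 : 0 < ‖z - r₁‖ := by linarith
  have hzr : z - r₁ ≠ 0 := norm_pos_iff.1 hz10
  have hmain : 0 ≤ 1 - ε ^ 2 / d ^ 2 := by
    rw [sub_nonneg, div_le_one (by rw [← sq_abs]; positivity), sq_le_sq, abs_of_pos hε]
    linarith
  have hnorm : ‖(((1 - ε ^ 2 / d ^ 2 : ℝ)) : ℂ)‖ = 1 - ε ^ 2 / d ^ 2 := by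
    rw [Complex.norm_real, Real.norm_of_nonneg hmain]
  rw [← hnorm]
  refine (abs_norm_sub_norm_le _ _).trans ?_
  have e : 1 - (ε : ℂ) ^ 2 / ((z - r₁) * d) - ((1 - ε ^ 2 / d ^ 2 : ℝ) : ℂ) =
      (ε : ℂ) ^ 2 * (z - r₂) / ((d : ℂ) ^ 2 * (z - r₁)) := by
    have hzd : z - r₂ = (z - r₁) - d := by simp [hdd]
    rw [hzd]
    push_cast
    field_simp
    ring
  rw [e, norm_div, norm_mul, norm_mul, norm_pow, norm_pow, hdc, Complex.norm_real,
    Real.norm_of_nonneg hε.le]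
  calc ε ^ 2 * ‖z - r₂‖ / (|d| ^ 2 * ‖z - r₁‖) ≤ ε ^ 2 * (2 * ε) / (|d| ^ 2 * (|d| / 2)) := by
        gcongr
    _ = 4 / |d| ^ 3 * ε ^ 3 := by
        field_simp
        ring

theorem norm_joukowski_sub_joukowski {r₁ r₂ ε : ℝ} {z : ℂ} (hz : z ≠ r₁) (hr : r₂ ≠ r₁) :
    ‖joukowski r₁ ε z - (realJoukowski r₁ ε r₂ : ℝ)‖ =
      ‖z - r₂‖ * ‖1 - (ε : ℂ) ^ 2 / ((z - r₁) * ((r₂ : ℂ) - r₁))‖ := by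
  rw [realJoukowski, ← joukowski_ofReal, joukowski_sub_joukowski hz (by exact_mod_cast hr),
    norm_mul]

theorem halfDisc_union_subset_iteratedHull {r₁ r₂ ε : ℝ} (hε : 0 < ε)
    (hd : 4 * ε ≤ |r₂ - r₁|) :
    halfDisc r₁ ε ∪ halfDisc r₂ ε ⊆ iteratedHull r₁ ε (realJoukowski r₁ ε r₂)
      (ε * (1 - ε ^ 2 / (r₂ - r₁) ^ 2 + 4 / |r₂ - r₁| ^ 3 * ε ^ 3)) := by
  have hr : r₂ ≠ r₁ := sub_ne_zero.1 (abs_pos.1 (by linarith))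
  rintro z (⟨hz, hz'⟩ | ⟨hz, hz'⟩)
  · exact ⟨hz, Or.inl hz'⟩
  · rw [Metric.mem_closedBall, dist_eq_norm] at hz'
    have hzr : z ≠ r₁ := by
      rintro rfl
      rw [← Complex.ofReal_sub, Complex.norm_real, Real.norm_eq_abs, abs_sub_comm] at hz'
      linarith
    refine ⟨hz, Or.inr ?_⟩
    rw [mem_preimage, Metric.mem_closedBall, dist_eq_norm, norm_joukowski_sub_joukowski hzr hr]
    have h := (abs_le.1 (abs_norm_joukowski_factor_sub_le hε hd (z := z) (by linarith))).2
    exact mul_le_mul hz' (by linarith) (norm_nonneg _) hε.le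

theorem iteratedHull_subset_halfDisc_union {r₁ r₂ ε : ℝ} (hε : 0 < ε)
    (hd : 4 * ε ≤ |r₂ - r₁|) :
    iteratedHull r₁ ε (realJoukowski r₁ ε r₂)
      (ε * (1 - ε ^ 2 / (r₂ - r₁) ^ 2 + -(4 / |r₂ - r₁| ^ 3) * ε ^ 3)) ⊆
      halfDisc r₁ ε ∪ halfDisc r₂ ε := by
  have hd0 : 0 < |r₂ - r₁| := by linarith
  have hr : r₂ ≠ r₁ := sub_ne_zero.1 (abs_pos.1 hd0)
  rintro z ⟨hz, hz'⟩
  by_cases h1 : z ∈ Metric.closedBall (r₁ : ℂ) ε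
  · exact Or.inl ⟨hz, h1⟩
  right
  refine ⟨hz, ?_⟩
  have hzr := ne_center_of_notMem_closedBall hε.le h1
  have h2 := hz'.resolve_left h1
  rw [Metric.mem_closedBall, not_le, dist_eq_norm] at h1
  rw [mem_preimage, Metric.mem_closedBall, dist_eq_norm,
    norm_joukowski_sub_joukowski hzr hr] at h2
  rw [Metric.mem_closedBall, dist_eq_norm]
  -- A crude bound first places `z` within distance `2 * ε` of `r₂`.
  have h3 : 3 / 4 ≤ ‖1 - (ε : ℂ) ^ 2 / ((z - r₁) * ((r₂ : ℂ) - r₁))‖ := by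
    have h4 := norm_sub_norm_le (1 : ℂ) ((ε : ℂ) ^ 2 / ((z - r₁) * ((r₂ : ℂ) - r₁)))
    have h5 : ‖(ε : ℂ) ^ 2 / ((z - r₁) * ((r₂ : ℂ) - r₁))‖ ≤ 1 / 4 := by
      rw [norm_div, norm_mul, norm_pow, ← Complex.ofReal_sub, Complex.norm_real,
        Complex.norm_real, Real.norm_of_nonneg hε.le, Real.norm_eq_abs,
        div_le_iff₀ (mul_pos (hε.trans h1) hd0)]
      nlinarith [mul_le_mul h1.le hd (by positivity) (norm_nonneg _)]
    rw [norm_one] at h4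
    linarith
  have hsq : 0 ≤ ε ^ 2 / (r₂ - r₁) ^ 2 := by positivity
  have hcu : 0 ≤ 4 / |r₂ - r₁| ^ 3 * ε ^ 3 := by positivity
  have h6 : ‖z - r₂‖ ≤ 2 * ε := by
    nlinarith [norm_nonneg (z - r₂), mul_nonneg hε.le hsq, mul_nonneg hε.le hcu]
  have h7 := (abs_le.1 (abs_norm_joukowski_factor_sub_le hε hd h6)).1
  by_contra! h8
  set q : ℝ := ε / |r₂ - r₁| with hq
  have hq4 : q ≤ 1 / 4 := by
    rw [hq, div_le_iff₀ hd0]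
    linarith
  have hq0 : 0 ≤ q := by positivity
  have e2 : ε ^ 2 / (r₂ - r₁) ^ 2 = q ^ 2 := by rw [hq, div_pow, sq_abs]
  have e3 : 4 / |r₂ - r₁| ^ 3 * ε ^ 3 = 4 * q ^ 3 := by rw [hq]; ring
  rw [e2, e3] at h7
  rw [neg_mul, e2, e3] at h2
  have hpos : 0 < 1 - q ^ 2 - 4 * q ^ 3 := by nlinarith [mul_nonneg hq0 hq0]
  nlinarith [norm_nonneg (z - r₂)]

/-! ### Expansion of the explicit probabilities -/

theorem differentiableAt_dslope_rpow_one (α : ℝ) :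
    DifferentiableAt ℝ (dslope (fun x : ℝ => x ^ α) 1) 1 := by
  have h : AnalyticAt ℝ (fun x : ℝ => x ^ α) 1 := by
    have h1 : AnalyticAt ℝ (fun x : ℝ => Real.exp (Real.log x * α)) 1 := by
      have := analyticAt_log (x := (1 : ℝ)) one_pos
      fun_prop
    refine h1.congr ?_
    filter_upwards [lt_mem_nhds one_pos] with x hx
    rw [Real.rpow_def_of_pos hx]
  obtain ⟨p, hp⟩ := h
  exact hp.has_fpower_series_dslope_fslope.differentiableAt

theorem dslope_rpow_one_self (α : ℝ) : dslope (fun x : ℝ => x ^ α) 1 1 = α := by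
  rw [dslope_same]
  simp

theorem rpow_eq_one_add_mul_dslope (α x : ℝ) :
    x ^ α = 1 + (x - 1) * dslope (fun x : ℝ => x ^ α) 1 x := by
  have h := sub_smul_dslope (fun x : ℝ => x ^ α) 1 x
  simp only [smul_eq_mul, Real.one_rpow] at h
  rw [h]
  ring

/-- With `f₁ = 1 - ε ^ 2 * Q₁`, `f₂ = 1 - ε ^ 2 * Q₂` and `f₃ = f₂ + ε ^ 4 * V`, the expression to
be expanded equals `(1 - f₁ ^ α) * (1 - f₂ ^ α) + f₁ ^ α * (f₃ ^ α - f₂ ^ α)`, and each of the two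
terms is `ε ^ 4` times a function that is differentiable at `0`. -/
theorem isBigO_inclusion_exclusion (α : ℝ) {Q₁ Q₂ V : ℝ → ℝ} (hQ₁ : DifferentiableAt ℝ Q₁ 0)
    (hQ₂ : DifferentiableAt ℝ Q₂ 0) (hV : DifferentiableAt ℝ V 0) :
    (fun ε : ℝ => 1 - (1 - ε ^ 2 * Q₁ ε) ^ α - (1 - ε ^ 2 * Q₂ ε) ^ α +
      ((1 - ε ^ 2 * Q₁ ε) * (1 - ε ^ 2 * Q₂ ε + ε ^ 4 * V ε)) ^ α -
      (α ^ 2 * Q₁ 0 * Q₂ 0 + α * V 0) * ε ^ 4) =O[𝓝 0] fun ε : ℝ => ε ^ 5 := by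
  let B : ℝ → ℝ := dslope (fun x : ℝ => x ^ α) 1
  let f₁ : ℝ → ℝ := fun ε => 1 - ε ^ 2 * Q₁ ε
  let f₂ : ℝ → ℝ := fun ε => 1 - ε ^ 2 * Q₂ ε
  let f₃ : ℝ → ℝ := fun ε => f₂ ε + ε ^ 4 * V ε
  let T : ℝ → ℝ := fun ε => Q₁ ε * Q₂ ε * B (f₁ ε) * B (f₂ ε) +
    f₁ ε ^ α * (f₂ ε ^ α / f₂ ε) * V ε * B (f₃ ε / f₂ ε)
  have hf₁ : DifferentiableAt ℝ f₁ 0 := by fun_prop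
  have hf₂ : DifferentiableAt ℝ f₂ 0 := by fun_prop
  have hf₃ : DifferentiableAt ℝ f₃ 0 := by fun_prop
  have e₁ : f₁ 0 = 1 := by simp [f₁]
  have e₂ : f₂ 0 = 1 := by simp [f₂]
  have e₃ : f₃ 0 = 1 := by simp [f₃, e₂]
  have hBf : ∀ {f : ℝ → ℝ}, DifferentiableAt ℝ f 0 → f 0 = 1 →
      DifferentiableAt ℝ (fun ε => B (f ε)) 0 := fun {f} hf hf0 =>
    DifferentiableAt.comp (g := B) (0 : ℝ) (by rw [hf0]; exact differentiableAt_dslope_rpow_one α)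
      hf
  have hpf : ∀ {f : ℝ → ℝ}, DifferentiableAt ℝ f 0 → f 0 = 1 →
      DifferentiableAt ℝ (fun ε => f ε ^ α) 0 := fun {f} hf hf0 =>
    hf.rpow_const (Or.inl (by rw [hf0]; exact one_ne_zero))
  have h20 : f₂ 0 ≠ 0 := by rw [e₂]; exact one_ne_zero
  have hT : DifferentiableAt ℝ T 0 :=
    (((hQ₁.mul hQ₂).mul (hBf hf₁ e₁)).mul (hBf hf₂ e₂)).add
      ((((hpf hf₁ e₁).mul ((hpf hf₂ e₂).div hf₂ h20)).mul hV).mul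
        (hBf (f := fun ε => f₃ ε / f₂ ε) (hf₃.div hf₂ h20) (by rw [e₂, e₃, div_one])))
  have hT0 : T 0 = α ^ 2 * Q₁ 0 * Q₂ 0 + α * V 0 := by
    simp only [T, e₁, e₂, e₃, B, dslope_rpow_one_self, Real.one_rpow, div_one]
    ring
  have hO := (Asymptotics.isBigO_refl (fun ε : ℝ => ε ^ 4) (𝓝 0)).mul hT.isBigO_sub
  refine (hO.congr' ?_ (Filter.Eventually.of_forall fun ε => by ring))
  have hp₁ := hf₁.continuousAt.eventually (lt_mem_nhds (show (0 : ℝ) < f₁ 0 by rw [e₁]; norm_num))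
  have hp₂ := hf₂.continuousAt.eventually (lt_mem_nhds (show (0 : ℝ) < f₂ 0 by rw [e₂]; norm_num))
  have hp₃ := hf₃.continuousAt.eventually (lt_mem_nhds (show (0 : ℝ) < f₃ 0 by rw [e₃]; norm_num))
  filter_upwards [hp₁, hp₂, hp₃] with ε h₁ h₂ h₃
  have g₁ := rpow_eq_one_add_mul_dslope α (f₁ ε)
  have g₂ := rpow_eq_one_add_mul_dslope α (f₂ ε)
  have g₃ : f₃ ε ^ α = f₂ ε ^ α * (1 + (f₃ ε / f₂ ε - 1) * B (f₃ ε / f₂ ε)) := by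
    rw [← rpow_eq_one_add_mul_dslope, ← Real.mul_rpow h₂.le (div_pos h₃ h₂).le,
      mul_div_cancel₀ _ h₂.ne']
  have g₄ : f₃ ε / f₂ ε - 1 = ε ^ 4 * V ε / f₂ ε := by
    rw [div_sub_one h₂.ne']
    simp only [f₃, add_sub_cancel_left]
  change ε ^ 4 * (T ε - T 0) = 1 - f₁ ε ^ α - f₂ ε ^ α + (f₁ ε * f₃ ε) ^ α - _
  have g₅ : (1 - f₁ ε ^ α) * (1 - f₂ ε ^ α) = ε ^ 4 * (Q₁ ε * Q₂ ε * B (f₁ ε) * B (f₂ ε)) := by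
    rw [g₁, g₂]
    simp only [f₁, f₂, B]
    ring
  have g₆ : f₁ ε ^ α * (f₃ ε ^ α - f₂ ε ^ α) =
      ε ^ 4 * (f₁ ε ^ α * (f₂ ε ^ α / f₂ ε) * V ε * B (f₃ ε / f₂ ε)) := by
    rw [g₃, g₄]
    ring
  rw [hT0, Real.mul_rpow h₁.le h₃.le]
  simp only [T]
  linear_combination -g₅ - g₆

theorem leading_coefficient_eq (α ε : ℝ) {u v d : ℝ} (hu : u ≠ 0) (hv : v ≠ 0) (hd : d ≠ 0)
    (hud : d - u ≠ 0) (hvd : d - v ≠ 0) :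
    α ^ 2 * ((u - v) ^ 2 / (u * v) ^ 2) * ((u - v) ^ 2 / ((u - d) * (v - d)) ^ 2) * ε ^ 4 +
      α * (2 * (u - v) ^ 2 / (d ^ 2 * u * v * (u - d) * (v - d))) * ε ^ 4 =
      α * (α - 1) * (u - v) ^ 4 * ε ^ 4 / (u ^ 2 * (d - u) ^ 2 * v ^ 2 * (d - v) ^ 2) +
        α * (u - v) ^ 2 * ε ^ 4 / (v ^ 2 * (d - u) ^ 2 * d ^ 2) +
        α * (u - v) ^ 2 * ε ^ 4 / (u ^ 2 * (d - v) ^ 2 * d ^ 2) := by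
  rw [show u - d = -(d - u) by ring, show v - d = -(d - v) by ring]
  field_simp
  ring

/-- The factors of the half-disc about `r₂` and of its counterpart in the iterated hull differ by
`ε ^ 4` times a differentiable function of `ε`.  The radius of the second disc of the hull matters
only up to order `ε ^ 3`; its `ε ^ 4` term `θ` is arbitrary. -/
theorem exists_discFactor_realJoukowski_eq (θ : ℝ) {a b r₁ r₂ : ℝ} (har₁ : a ≠ r₁)
    (har₂ : a ≠ r₂) (hbr₁ : b ≠ r₁) (hbr₂ : b ≠ r₂) (hr : r₂ ≠ r₁) :
    ∃ V : ℝ → ℝ, DifferentiableAt ℝ V 0 ∧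
      V 0 = 2 * (a - b) ^ 2 /
        ((r₂ - r₁) ^ 2 * (a - r₁) * (b - r₁) * (a - r₂) * (b - r₂)) ∧
      ∀ᶠ ε in 𝓝 0, discFactor (realJoukowski r₁ ε a - realJoukowski r₁ ε r₂)
          (realJoukowski r₁ ε b - realJoukowski r₁ ε r₂)
          ((ε * (1 - ε ^ 2 / (r₂ - r₁) ^ 2 + θ * ε ^ 3)) ^ 2) =
        discFactor (a - r₂) (b - r₂) (ε ^ 2) + ε ^ 4 * V ε := by
  obtain ⟨u, hu⟩ : ∃ u, u = a - r₁ := ⟨_, rfl⟩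
  obtain ⟨v, hv⟩ : ∃ v, v = b - r₁ := ⟨_, rfl⟩
  obtain ⟨d, hd⟩ : ∃ d, d = r₂ - r₁ := ⟨_, rfl⟩
  have hu0 : u ≠ 0 := hu ▸ sub_ne_zero.2 har₁
  have hv0 : v ≠ 0 := hv ▸ sub_ne_zero.2 hbr₁
  have hd0 : d ≠ 0 := hd ▸ sub_ne_zero.2 hr
  have hx0 : u - d ≠ 0 := by
    rw [hu, hd, sub_sub_sub_cancel_right]
    exact sub_ne_zero.2 har₂
  have hy0 : v - d ≠ 0 := by
    rw [hv, hd, sub_sub_sub_cancel_right]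
    exact sub_ne_zero.2 hbr₂
  have hdiff : ∀ k n D E : ℝ, D ≠ 0 → E ≠ 0 → 1 - k * n ^ 2 / D ^ 2 =
      1 - k / E ^ 2 + k * (D - n * E) / (D * E) * (1 / E + n / D) := by
    intro k n D E hD hE
    field_simp
    ring
  -- The factor of the iterated hull is `1 - ε ^ 2 * ((u - v) * N / D) ^ 2` and that of the
  -- half-disc about `r₂` is `1 - ε ^ 2 * ((u - v) / E) ^ 2`, with `D - N * E = ε ^ 2 * W`.
  let e : ℝ → ℝ := fun ε => 1 - ε ^ 2 / d ^ 2 + θ * ε ^ 3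
  let N : ℝ → ℝ := fun ε => e ε * (1 - ε ^ 2 / (u * v))
  let E : ℝ → ℝ := fun ε => (u - d) * (v - d) - ε ^ 2
  let D : ℝ → ℝ := fun ε => (u - d) * (v - d) * (1 - ε ^ 2 / (u * d)) * (1 - ε ^ 2 / (v * d)) -
    ε ^ 2 * e ε ^ 2
  let W : ℝ → ℝ := fun ε => (u - d) * (v - d) *
      (ε ^ 2 / (u * v * d ^ 2) - 1 / (u * d) - 1 / (v * d) - (θ * ε - 1 / d ^ 2) + e ε / (u * v)) -
      e ε ^ 2 + e ε * (1 - ε ^ 2 / (u * v))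
  let V : ℝ → ℝ := fun ε => (u - v) ^ 2 * W ε / (D ε * E ε) * (1 / E ε + N ε / D ε)
  have he : DifferentiableAt ℝ e 0 := by fun_prop
  have hN : DifferentiableAt ℝ N 0 := by fun_prop
  have hE : DifferentiableAt ℝ E 0 := by fun_prop
  have hD : DifferentiableAt ℝ D 0 := by fun_prop
  have hW : DifferentiableAt ℝ W 0 := by fun_prop
  have e0 : e 0 = 1 := by simp [e]
  have N0 : N 0 = 1 := by simp [N, e0]
  have E0 : E 0 = (u - d) * (v - d) := by simp [E]
  have D0 : D 0 = (u - d) * (v - d) := by simp [D]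
  have W0 : W 0 = ((u - d) * (v - d)) ^ 2 / (d ^ 2 * u * v) := by
    simp only [W, e0]
    field_simp
    ring
  have hE0 : E 0 ≠ 0 := E0 ▸ mul_ne_zero hx0 hy0
  have hD0 : D 0 ≠ 0 := D0 ▸ mul_ne_zero hx0 hy0
  have hV : DifferentiableAt ℝ V 0 := by
    have hDE := mul_ne_zero hD0 hE0
    fun_prop (disch := assumption)
  have hxa : a - r₂ = u - d := by rw [hu, hd]; ring
  have hyb : b - r₂ = v - d := by rw [hv, hd]; ring
  refine ⟨V, hV, ?_, ?_⟩
  · rw [hxa, hyb, ← hu, ← hv, ← hd, show a - b = u - v by rw [hu, hv]; ring]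
    simp only [V, W0, D0, E0, N0]
    field_simp
    ring
  filter_upwards [hD.continuousAt.eventually_ne hD0, hE.continuousAt.eventually_ne hE0]
    with ε hDε hEε
  have hW' : ε ^ 2 * W ε = D ε - N ε * E ε := by
    simp only [W, D, N, E, e]
    field_simp
    ring
  have hden : (u - d) * (1 - ε ^ 2 / (u * d)) * ((v - d) * (1 - ε ^ 2 / (v * d))) -
      (ε * e ε) ^ 2 = D ε := by
    simp only [D]
    ring
  have hnum : (u - d) * (1 - ε ^ 2 / (u * d)) - (v - d) * (1 - ε ^ 2 / (v * d)) =
      (u - v) * (1 - ε ^ 2 / (u * v)) := by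
    field_simp
    ring
  rw [realJoukowski_sub har₁ hr, realJoukowski_sub hbr₁ hr, ← hu, ← hv, ← hd, hxa, hyb]
  change discFactor _ _ ((ε * e ε) ^ 2) = _
  have hE' : (u - d) * (v - d) - ε ^ 2 = E ε := rfl
  rw [discFactor, hden, hnum, discFactor, sub_sub_sub_cancel_right, hE']
  have hV' : ε ^ 4 * V ε =
      ε ^ 2 * (u - v) ^ 2 * (ε ^ 2 * W ε) / (D ε * E ε) * (1 / E ε + N ε / D ε) := by
    simp only [V]
    ring
  rw [hV', hW']
  have hN' : (ε * e ε) ^ 2 * ((u - v) * (1 - ε ^ 2 / (u * v))) ^ 2 =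
      ε ^ 2 * (u - v) ^ 2 * N ε ^ 2 := by
    simp only [N]
    ring
  rw [hN']
  exact hdiff _ _ _ _ hDε hEε

/-- The expansion of the inclusion-exclusion formula in which the probability of missing both
half-discs is replaced by that of missing an iterated hull. -/
theorem isBigO_discFactor_inclusion_exclusion (α θ : ℝ) {a b r₁ r₂ : ℝ} (har₁ : a ≠ r₁)
    (har₂ : a ≠ r₂) (hbr₁ : b ≠ r₁) (hbr₂ : b ≠ r₂) (hr : r₂ ≠ r₁) :
    (fun ε : ℝ => 1 - discFactor (a - r₁) (b - r₁) (ε ^ 2) ^ α -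
      discFactor (a - r₂) (b - r₂) (ε ^ 2) ^ α +
      (discFactor (a - r₁) (b - r₁) (ε ^ 2) *
        discFactor (realJoukowski r₁ ε a - realJoukowski r₁ ε r₂)
          (realJoukowski r₁ ε b - realJoukowski r₁ ε r₂)
          ((ε * (1 - ε ^ 2 / (r₂ - r₁) ^ 2 + θ * ε ^ 3)) ^ 2)) ^ α -
      (α * (α - 1) * (a - b) ^ 4 * ε ^ 4 /
          ((r₁ - a) ^ 2 * (r₂ - a) ^ 2 * (r₁ - b) ^ 2 * (r₂ - b) ^ 2)
        + α * (a - b) ^ 2 * ε ^ 4 / ((r₁ - b) ^ 2 * (r₂ - a) ^ 2 * (r₂ - r₁) ^ 2)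
        + α * (a - b) ^ 2 * ε ^ 4 / ((r₁ - a) ^ 2 * (r₂ - b) ^ 2 * (r₂ - r₁) ^ 2)))
      =O[𝓝 0] fun ε : ℝ => ε ^ 5 := by
  obtain ⟨V, hV, hV0, hVε⟩ :=
    exists_discFactor_realJoukowski_eq θ har₁ har₂ hbr₁ hbr₂ hr
  have hQ : ∀ {x y : ℝ}, x ≠ 0 → y ≠ 0 →
      DifferentiableAt ℝ (fun ε : ℝ => (x - y) ^ 2 / (x * y - ε ^ 2) ^ 2) 0 := by
    intro x y hx hy
    have : (x * y - 0 ^ 2) ^ 2 ≠ 0 := by simp [hx, hy]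
    fun_prop (disch := assumption)
  have hF : ∀ x y ε : ℝ,
      discFactor x y (ε ^ 2) = 1 - ε ^ 2 * ((x - y) ^ 2 / (x * y - ε ^ 2) ^ 2) := fun x y ε => by
    rw [discFactor, mul_div_assoc]
  have hO := isBigO_inclusion_exclusion α (hQ (sub_ne_zero.2 har₁) (sub_ne_zero.2 hbr₁))
    (hQ (sub_ne_zero.2 har₂) (sub_ne_zero.2 hbr₂)) hV
  refine hO.congr' ?_ Filter.EventuallyEq.rfl
  filter_upwards [hVε] with ε hε
  rw [hε, hF, hF]
  congr 1
  have hc := leading_coefficient_eq α ε (sub_ne_zero.2 har₁) (sub_ne_zero.2 hbr₁)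
    (sub_ne_zero.2 hr) (u := a - r₁) (v := b - r₁) (by
      rw [sub_sub_sub_cancel_right]
      exact sub_ne_zero.2 har₂.symm) (by
      rw [sub_sub_sub_cancel_right]
      exact sub_ne_zero.2 hbr₂.symm)
  simp only [sub_sub_sub_cancel_right] at hc ⊢
  rw [hV0, ← neg_sub a r₁, ← neg_sub b r₁, neg_sq, neg_sq, ← hc]
  ring

/-! ### The expansion for every restriction measure -/

theorem continuousAt_realJoukowski_sub {r₁ r₂ x : ℝ} :
    ContinuousAt (fun ε => realJoukowski r₁ ε x - realJoukowski r₁ ε r₂) 0 := by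
  unfold realJoukowski
  simp only [div_eq_mul_inv]
  fun_prop

theorem eventually_measureReal_missEvent_iteratedHull (α θ : ℝ) {a b r₁ r₂ : ℝ} (hab : a ≠ b)
    (har₁ : a ≠ r₁) (har₂ : a ≠ r₂) (hbr₁ : b ≠ r₁) (hbr₂ : b ≠ r₂) :
    ∀ᶠ ε in 𝓝[>] (0 : ℝ), ∀ μ : Measure (NonemptyCompacts ℂ),
      IsChordalRestrictionMeasure a b α μ →
      μ.real (missEvent (iteratedHull r₁ ε (realJoukowski r₁ ε r₂)
          (ε * (1 - ε ^ 2 / (r₂ - r₁) ^ 2 + θ * ε ^ 3)))) =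
        (discFactor (a - r₁) (b - r₁) (ε ^ 2) *
          discFactor (realJoukowski r₁ ε a - realJoukowski r₁ ε r₂)
            (realJoukowski r₁ ε b - realJoukowski r₁ ε r₂)
            ((ε * (1 - ε ^ 2 / (r₂ - r₁) ^ 2 + θ * ε ^ 3)) ^ 2)) ^ α := by
  have hfac : ContinuousAt (fun ε : ℝ => 1 - ε ^ 2 / (r₂ - r₁) ^ 2 + θ * ε ^ 3) 0 := by fun_prop
  have hrad : ContinuousAt (fun ε : ℝ => ε * (1 - ε ^ 2 / (r₂ - r₁) ^ 2 + θ * ε ^ 3)) 0 := by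
    fun_prop
  have hlt : ∀ {f g : ℝ → ℝ}, ContinuousAt f 0 → ContinuousAt g 0 → f 0 < g 0 →
      ∀ᶠ ε in 𝓝[>] (0 : ℝ), f ε < g ε := fun hf hg h =>
    (hf.eventually_lt hg h).filter_mono nhdsWithin_le_nhds
  have hlt' : ∀ x : ℝ, x ≠ r₂ → ∀ᶠ ε in 𝓝[>] (0 : ℝ),
      ε * (1 - ε ^ 2 / (r₂ - r₁) ^ 2 + θ * ε ^ 3) <
        |realJoukowski r₁ ε x - realJoukowski r₁ ε r₂| := fun x hx =>
    hlt hrad continuousAt_realJoukowski_sub.abs (by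
      simpa [realJoukowski] using sub_ne_zero.2 hx)
  filter_upwards [self_mem_nhdsWithin, hlt (f := fun _ => 0) continuousAt_const hfac (by simp),
    hlt continuousAt_id continuousAt_const (abs_pos.2 (sub_ne_zero.2 har₁)),
    hlt continuousAt_id continuousAt_const (abs_pos.2 (sub_ne_zero.2 hbr₁)),
    hlt' a har₂, hlt' b hbr₂] with ε (hε : 0 < ε) h1 h2 h3 h4 h5 μ hμ
  exact hμ.measureReal_missEvent_iteratedHull hab hε (mul_pos hε h1) h2 h3 h4 h5

theorem eventually_discFactor_pos {x y : ℝ} (hx : x ≠ 0) (hy : y ≠ 0) :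
    ∀ᶠ ε in 𝓝[>] (0 : ℝ), 0 < discFactor x y (ε ^ 2) := by
  have hc : ContinuousAt (fun ε : ℝ => discFactor x y (ε ^ 2)) 0 := by
    unfold discFactor
    have : (x * y - 0 ^ 2) ^ 2 ≠ 0 := by simp [hx, hy]
    fun_prop (disch := assumption)
  exact (hc.eventually (lt_mem_nhds (by simp [discFactor]))).filter_mono nhdsWithin_le_nhds

/-- The two iterated hulls that enclose the union of the half-discs have the same expansion up to
order `ε ^ 5`, so the union has it too. -/
theorem exists_eventually_abs_measureReal_sub_le (a b r₁ r₂ α : ℝ)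
    (hab : a ≠ b) (har₁ : a ≠ r₁) (har₂ : a ≠ r₂) (hbr₁ : b ≠ r₁) (hbr₂ : b ≠ r₂)
    (hr : r₂ ≠ r₁) :
    ∃ C : ℝ, ∀ᶠ ε in 𝓝[>] (0 : ℝ), ∀ μ : Measure (NonemptyCompacts ℂ),
      IsChordalRestrictionMeasure a b α μ →
        |μ.real (hitEvent (Metric.ball (r₁ : ℂ) ε) ∩ hitEvent (Metric.ball (r₂ : ℂ) ε))
          - (α * (α - 1) * (a - b) ^ 4 * ε ^ 4 /
                ((r₁ - a) ^ 2 * (r₂ - a) ^ 2 * (r₁ - b) ^ 2 * (r₂ - b) ^ 2)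
              + α * (a - b) ^ 2 * ε ^ 4 / ((r₁ - b) ^ 2 * (r₂ - a) ^ 2 * (r₂ - r₁) ^ 2)
              + α * (a - b) ^ 2 * ε ^ 4 / ((r₁ - a) ^ 2 * (r₂ - b) ^ 2 * (r₂ - r₁) ^ 2))|
          ≤ C * ε ^ 5 := by
  have hd : 0 < |r₂ - r₁| := abs_pos.2 (sub_ne_zero.2 hr)
  obtain ⟨C₁, hC₁⟩ := (isBigO_discFactor_inclusion_exclusion α (4 / |r₂ - r₁| ^ 3) har₁ har₂
    hbr₁ hbr₂ hr).bound
  obtain ⟨C₂, hC₂⟩ := (isBigO_discFactor_inclusion_exclusion α (-(4 / |r₂ - r₁| ^ 3)) har₁ har₂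
    hbr₁ hbr₂ hr).bound
  refine ⟨max C₁ C₂, ?_⟩
  have hlt : ∀ {c : ℝ}, 0 < c → ∀ᶠ ε in 𝓝[>] (0 : ℝ), ε < c := fun hc =>
    mem_nhdsWithin_of_mem_nhds (gt_mem_nhds hc)
  filter_upwards [self_mem_nhdsWithin, hC₁.filter_mono nhdsWithin_le_nhds,
    hC₂.filter_mono nhdsWithin_le_nhds,
    eventually_measureReal_missEvent_iteratedHull α (4 / |r₂ - r₁| ^ 3) hab har₁ har₂ hbr₁ hbr₂,
    eventually_measureReal_missEvent_iteratedHull α (-(4 / |r₂ - r₁| ^ 3)) hab har₁ har₂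
      hbr₁ hbr₂,
    eventually_discFactor_pos (sub_ne_zero.2 har₁) (sub_ne_zero.2 hbr₁),
    eventually_discFactor_pos (sub_ne_zero.2 har₂) (sub_ne_zero.2 hbr₂),
    hlt (abs_pos.2 (sub_ne_zero.2 har₁)), hlt (abs_pos.2 (sub_ne_zero.2 hbr₁)),
    hlt (abs_pos.2 (sub_ne_zero.2 har₂)), hlt (abs_pos.2 (sub_ne_zero.2 hbr₂)),
    hlt (show 0 < |r₂ - r₁| / 4 by positivity)]
    with ε (hε : 0 < ε) h₁ h₂ m₁ m₂ p₁ p₂ la₁ lb₁ la₂ lb₂ ld μ hμ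
  have := hμ.isProbabilityMeasure
  rw [hμ.measureReal_hitEvent_inter hab hε la₁ lb₁ la₂ lb₂ p₁ p₂]
  have i₁ : μ.real _ ≤ μ.real _ := measureReal_mono (missEvent_anti
    (halfDisc_union_subset_iteratedHull (r₁ := r₁) (r₂ := r₂) hε (by linarith)))
  have i₂ : μ.real _ ≤ μ.real _ := measureReal_mono (missEvent_anti
    (iteratedHull_subset_halfDisc_union (r₁ := r₁) (r₂ := r₂) hε (by linarith)))
  have hε5 : 0 < ε ^ 5 := pow_pos hε 5
  rw [m₁ μ hμ] at i₁
  rw [m₂ μ hμ] at i₂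
  rw [Real.norm_eq_abs, Real.norm_of_nonneg hε5.le, abs_le] at h₁ h₂
  have g₁ := mul_le_mul_of_nonneg_right (le_max_left C₁ C₂) hε5.le
  have g₂ := mul_le_mul_of_nonneg_right (le_max_right C₁ C₂) hε5.le
  rw [abs_le]
  constructor
  · linarith [h₁.1]
  · linarith [h₂.2]

end ChordalRestriction

theorem mainTheorem4 (a b r₁ r₂ α : ℝ)
    (hab : a ≠ b) (har₁ : a ≠ r₁) (har₂ : a ≠ r₂) (hbr₁ : b ≠ r₁) (hbr₂ : b ≠ r₂)
    (hr : r₁ ≠ r₂) :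
    ∃ C : ℝ, ∀ μ : Measure (NonemptyCompacts ℂ),
      ChordalRestriction.IsChordalRestrictionMeasure a b α μ →
      ∀ ε : ℝ, 0 < ε → ε ≤ 1 →
        |μ.real (ChordalRestriction.hitEvent (Metric.ball (r₁ : ℂ) ε) ∩
              ChordalRestriction.hitEvent (Metric.ball (r₂ : ℂ) ε))
          - (α * (α - 1) * (a - b) ^ 4 * ε ^ 4 /
                ((r₁ - a) ^ 2 * (r₂ - a) ^ 2 * (r₁ - b) ^ 2 * (r₂ - b) ^ 2)
              + α * (a - b) ^ 2 * ε ^ 4 / ((r₁ - b) ^ 2 * (r₂ - a) ^ 2 * (r₂ - r₁) ^ 2)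
              + α * (a - b) ^ 2 * ε ^ 4 / ((r₁ - a) ^ 2 * (r₂ - b) ^ 2 * (r₂ - r₁) ^ 2))|
          ≤ C * ε ^ 5 := by
  obtain ⟨C, hC⟩ := ChordalRestriction.exists_eventually_abs_measureReal_sub_le a b r₁ r₂ α hab
    har₁ har₂ hbr₁ hbr₂ hr.symm
  obtain ⟨δ, hδ, hδC⟩ := mem_nhdsGT_iff_exists_Ioo_subset.1 hC
  have hδ0 : (0 : ℝ) < δ := hδ
  obtain ⟨c, hc⟩ : ∃ c : ℝ, c = α * (α - 1) * (a - b) ^ 4 /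
        ((r₁ - a) ^ 2 * (r₂ - a) ^ 2 * (r₁ - b) ^ 2 * (r₂ - b) ^ 2)
      + α * (a - b) ^ 2 / ((r₁ - b) ^ 2 * (r₂ - a) ^ 2 * (r₂ - r₁) ^ 2)
      + α * (a - b) ^ 2 / ((r₁ - a) ^ 2 * (r₂ - b) ^ 2 * (r₂ - r₁) ^ 2) := ⟨_, rfl⟩
  -- For `ε ≥ δ` both the probability and the leading term are bounded.
  refine ⟨max C ((1 + |c|) / δ ^ 5), fun μ hμ ε hε hε1 => ?_⟩
  have hε5 : 0 < ε ^ 5 := pow_pos hε 5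
  rcases lt_or_ge ε δ with h | h
  · exact (hδC ⟨hε, h⟩ μ hμ).trans (mul_le_mul_of_nonneg_right (le_max_left _ _) hε5.le)
  · have := hμ.isProbabilityMeasure
    refine le_trans ?_ (mul_le_mul_of_nonneg_right (le_max_right _ _) hε5.le)
    have h1 : 1 + |c| ≤ (1 + |c|) / δ ^ 5 * ε ^ 5 := by
      rw [div_mul_eq_mul_div, le_div_iff₀ (pow_pos hδ0 5)]
      gcongr
    refine le_trans ?_ h1
    have h2 : |c * ε ^ 4| ≤ |c| := by
      rw [abs_mul, abs_of_pos (pow_pos hε 4)]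
      exact mul_le_of_le_one_right (abs_nonneg c) (pow_le_one₀ hε.le hε1)
    set p := μ.real (ChordalRestriction.hitEvent (Metric.ball (r₁ : ℂ) ε) ∩
      ChordalRestriction.hitEvent (Metric.ball (r₂ : ℂ) ε))
    have h3 : |p| ≤ 1 := by
      rw [abs_of_nonneg measureReal_nonneg]
      exact measureReal_le_one
    calc _ = |p - c * ε ^ 4| := by
          rw [hc]
          congr 2
          ring
      _ ≤ |p| + |c * ε ^ 4| := by
          rw [sub_eq_add_neg]
          exact (abs_add_le _ _).trans_eq (by rw [abs_neg])
      _ ≤ 1 + |c| := add_le_add h3 h2
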